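/- Let $n\ge 2$, $\Gamma=\{1,\dots,n\}$, and let $(\Gamma,E_k)$, $k\in\mathcal I$, be a finite family of connected undirected simple graphs; $N_{ik}$ is the set of neighbours of $i$ in $E_k$. Fix $\xi>0$, let $D=[-\xi,\xi]^{\Gamma\times\Gamma}$, and call a continuous map $d:[0,\infty)\to D$ a disturbance realization. A switching function is a right-continuous, piecewise constant $\sigma:[0,\infty)\to\mathcal I$; its switching times are the $t>0$ with $\sigma(t^-)\ne\sigma(t^+)$. The state $x:[0,\infty)\to\mathbb R^n$ is continuous and, at every $t\geq 0$ that is not a switching time, satisfies, with $k=\sigma(t)$, $$\dot x_i=\sum_{j\in N_{ik}}(\tilde y_{ij}-x_i),\qquad i\in\Gamma,$$ where $y_{ij}=x_j+d_{ij}(t)$ and $(\tilde y_{ij})_{j\in N_{ik}}$ is chosen by the lazy rule: it minimizes $\bigl|\sum_{j\in N_{ik}}(\tilde y_{ij}-x_i)\bigr|$ subject to $\tilde y_{ij}\in[y_{ij}-\xi,y_{ij}+\xi]$ for $j\in N_{ik}$ (multiple minimizers give the same $\dot x_i$). Put $\mathcal V(x)=\max_i x_i-\min_i x_i$. For $d\in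 D$ let $P(d,E_k)$ be the set of the $x\in\mathbb R^n$ with $$-\frac{\sum_{j\in N_{ik}}d_{ij}}{|N_{ik}|}-\xi\le\frac{\sum_{j\in N_{ik}}x_j}{|N_{ik}|}-x_i\le-\frac{\sum_{j\in N_{ik}}d_{ij}}{|N_{ik}|}+\xi\qquad\text{for all } i\in\Gamma,$$ and let $P(D,E_k)=\bigcup_{d\in D}P(d,E_k)$, $P(D,E_k)+\nu=\{x:\exists y\in P(D,E_k),\ \|x-y\|_\infty\le\nu\}$, $L(D,E_k)=\max_{x\in P(D,E_k)}\mathcal V(x)$ and $S(D,E_k,\nu)=\{x\in\mathbb R^n:\mathcal V(x)\le L(D,E_k)+2\nu\}$. Let $\nu>0$ and $0<\gamma<1$. Call $q>0$ admissible for $E_k$ if, for every disturbance realization, every $t\ge0$ and every solution $x$ on $[t,t+q]$ of the above equation with fixed edgeset $E_k$, there is $s\in[t,t+q]$ such that $\mathcal V(x(s))<\gamma\,\mathcal V(x(t))$ or $x(s)\in P(D,E_k)+\nu$. **Theorem.** The maxima $L(D,E_k)$ exist, and for every $k\in\mathcal I$ there is an admissible time. Moreover, let $q_k(\nu,\gamma)$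 be any admissible time for $E_k$, $k\in\mathcal I$, and put $\tau(\nu,\gamma)=\max_{k\in\mathcal I}q_k(\nu,\gamma)$. Let $\sigma$ be any switching function such that any two distinct switching times are at least $\tau(\nu,\gamma)$ apart and every $k\in\mathcal I$ is recurrent (for all $t\ge0$ there is $t_k\ge t$ with $\sigma(t_k)=k$). Then, for every disturbance realization and every resulting state trajectory $x$ (whatever its initial state), there is a finite time $\bar t>0$ such that $$x(t)\in T=\bigcap_{k\in\mathcal I}S(D,E_k,\nu)\qquad\text{for all } t\ge\bar t .$$ -/

import Mathlib

open Filter Topology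

/-- The neighbourhood `N_i` of agent `i` in the network with edgeset `G`. -/
noncomputable def nbrs {n : ℕ} (G : SimpleGraph (Fin n)) (i : Fin n) : Finset (Fin n) :=
  haveI := Classical.decRel G.Adj
  Finset.univ.filter fun j => G.Adj i j

/-- The hypercube `D` of the disturbance vectors with all entries in `[-ξ, ξ]`. -/
def disturbanceBox (n : ℕ) (ξ : ℝ) : Set (Fin n → Fin n → ℝ) :=
  {d | ∀ i j, -ξ ≤ d i j ∧ d i j ≤ ξ}

/-- A disturbance realization: continuous in time, with values in the hypercube `D`. -/
def IsDisturbance {n : ℕ} (ξ : ℝ) (d : ℝ → Fin n → Fin n → ℝ) : Prop :=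
  ContinuousOn d (Set.Ici 0) ∧ ∀ t, 0 ≤ t → d t ∈ disturbanceBox n ξ

/-- The estimates compatible with the measures `y j`, `j ∈ N`. -/
def candidateEstimates {n : ℕ} (N : Finset (Fin n)) (ξ : ℝ) (y : Fin n → ℝ) :
    Set (Fin n → ℝ) :=
  {z | ∀ j ∈ N, z j ∈ Set.Icc (y j - ξ) (y j + ξ)}

/-- The lazy rule for an agent with state `xi`, neighbourhood `N` and measures `y`: the
estimates `z` minimize `|∑ j ∈ N, (z j - xi)|` among all the compatible estimates. -/
def IsLazyEstimate {n : ℕ} (N : Finset (Fin n)) (ξ xi : ℝ) (y z : Fin n → ℝ) : Prop :=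
  z ∈ candidateEstimates N ξ y ∧
    IsMinOn (fun w : Fin n → ℝ => |∑ j ∈ N, (w j - xi)|) (candidateEstimates N ξ y) z

/-- `v` is the control vector produced by the linear protocol with the lazy rule, on the edgeset
`G`, at the state `x` and for the disturbance `d` (so that agent `i` measures `x j + d i j`). -/
def IsLazyControl {n : ℕ} (G : SimpleGraph (Fin n)) (ξ : ℝ) (d : Fin n → Fin n → ℝ)
    (x v : Fin n → ℝ) : Prop :=
  ∀ i, ∃ z : Fin n → ℝ,
    IsLazyEstimate (nbrs G i) ξ (x i) (fun j => x j + d i j) z ∧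
      v i = ∑ j ∈ nbrs G i, (z j - x i)

/-- The switching times of `σ`: the times `t > 0` with `σ(t⁻) ≠ σ(t⁺)`. -/
def switchingTimes {I : Type*} (σ : ℝ → I) : Set ℝ :=
  {t | 0 < t ∧ ∃ k l, k ≠ l ∧ (∀ᶠ s in 𝓝[<] t, σ s = k) ∧ (∀ᶠ s in 𝓝[>] t, σ s = l)}

/-- A switching function on `[0, ∞)`: at each time it is constant on some interval to the right,
which includes that time, and constant on some interval to the left. -/
def IsSwitchingFunction {I : Type*} (σ : ℝ → I) : Prop :=
  (∀ t, 0 ≤ t → ∀ᶠ s in 𝓝[>] t, σ s = σ t) ∧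
    ∀ t, 0 < t → ∃ k, ∀ᶠ s in 𝓝[<] t, σ s = k

/-- Any two switching times are at least `τ` apart. -/
def HasDwellTime {I : Type*} (σ : ℝ → I) (τ : ℝ) : Prop :=
  ∀ s ∈ switchingTimes σ, ∀ t ∈ switchingTimes σ, s < t → τ ≤ t - s

/-- Every index is visited at arbitrarily late times. -/
def IsRecurrent {I : Type*} (σ : ℝ → I) : Prop :=
  ∀ k, ∀ t, 0 ≤ t → ∃ s, t ≤ s ∧ σ s = k

/-- `x` is, over the time interval `J`, a state trajectory of the switched network with edgesets
`E k`, switching function `σ` and disturbance realization `d`, controlled by the linear protocol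
with the lazy rule: it is continuous (in particular across the switching times) and satisfies
`ẋ = u` at the other times. At the endpoints of `J` the one-sided equation follows by continuity,
so it is required in the interior only. -/
def IsTrajectoryOn {n : ℕ} {I : Type*} (J : Set ℝ) (E : I → SimpleGraph (Fin n)) (σ : ℝ → I)
    (ξ : ℝ) (d : ℝ → Fin n → Fin n → ℝ) (x : ℝ → Fin n → ℝ) : Prop :=
  ContinuousOn x J ∧
    ∀ t ∈ interior J, t ∉ switchingTimes σ →
      ∃ v, IsLazyControl (E (σ t)) ξ (d t) (x t) v ∧ HasDerivAt x v t

/-- A trajectory over `J` of the network with fixed edgeset `G`. -/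
def IsFixedTrajectoryOn {n : ℕ} (J : Set ℝ) (G : SimpleGraph (Fin n))
    (ξ : ℝ) (d : ℝ → Fin n → Fin n → ℝ) (x : ℝ → Fin n → ℝ) : Prop :=
  IsTrajectoryOn J (fun _ : Unit => G) (fun _ => ()) ξ d x

/-- `𝒱(x)`, the maximum difference between two components of `x`. -/
noncomputable def spread {n : ℕ} (x : Fin n → ℝ) : ℝ :=
  (⨆ i, x i) - ⨅ i, x i

/-- The polyhedron `P(d, E)` of the equilibrium points for the constant disturbance `d`. -/
noncomputable def polyP {n : ℕ} (ξ : ℝ) (d : Fin n → Fin n → ℝ) (G : SimpleGraph (Fin n)) :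
    Set (Fin n → ℝ) :=
  {x | ∀ i,
    -((∑ j ∈ nbrs G i, d i j) / ((nbrs G i).card : ℝ)) - ξ
        ≤ (∑ j ∈ nbrs G i, x j) / ((nbrs G i).card : ℝ) - x i ∧
    (∑ j ∈ nbrs G i, x j) / ((nbrs G i).card : ℝ) - x i
        ≤ -((∑ j ∈ nbrs G i, d i j) / ((nbrs G i).card : ℝ)) + ξ}

/-- `P(Q, E)`, the union of the `P(d, E)` over `d ∈ Q`. -/
noncomputable def setP {n : ℕ} (ξ : ℝ) (Q : Set (Fin n → Fin n → ℝ)) (G : SimpleGraph (Fin n)) :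
    Set (Fin n → ℝ) :=
  ⋃ d ∈ Q, polyP ξ d G

/-- `A + ν`, the points at distance at most `ν` from a point of `A` in the sup norm (which is the
norm of `Fin n → ℝ`). -/
def fatten {n : ℕ} (A : Set (Fin n → ℝ)) (ν : ℝ) : Set (Fin n → ℝ) :=
  {x | ∃ y ∈ A, ‖x - y‖ ≤ ν}

/-- `L(Q, E)`, the maximum of `𝒱` over `P(Q, E)`. -/
noncomputable def maxSpread {n : ℕ} (ξ : ℝ) (Q : Set (Fin n → Fin n → ℝ))
    (G : SimpleGraph (Fin n)) : ℝ :=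
  sSup (spread '' setP ξ Q G)

/-- The tube `S(Q, E, ν)`. -/
noncomputable def tubeS {n : ℕ} (ξ : ℝ) (Q : Set (Fin n → Fin n → ℝ)) (G : SimpleGraph (Fin n))
    (ν : ℝ) : Set (Fin n → ℝ) :=
  {x | spread x ≤ maxSpread ξ Q G + 2 * ν}

/-- `q` is an admissible value of `q(ν, γ)` for the fixed edgeset `G`: it is positive and, from any
initial time `t`, any initial state and under any disturbance realization, within a time `q` either
`𝒱` has dropped below `γ` times its value at `t` or the state has reached `P(D, E) + ν`. -/
def IsSettlingTime {n : ℕ} (G : SimpleGraph (Fin n)) (ξ ν γ q : ℝ) : Prop :=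
  0 < q ∧ ∀ d, IsDisturbance ξ d → ∀ t, 0 ≤ t → ∀ x : ℝ → Fin n → ℝ,
    IsFixedTrajectoryOn (Set.Icc t (t + q)) G ξ d x →
      ∃ s ∈ Set.Icc t (t + q),
        spread (x s) < γ * spread (x t) ∨ x s ∈ fatten (setP ξ (disturbanceBox n ξ) G) ν

/-
With `L` the Laplacian of a connected graph, the lazy control satisfies `|v i| ≤ |(L x) i|`,
`v i * (L x) i ≤ 0` and `|v i + (L x) i| ≤ 2 * deg i * ξ`, while `P(D, E)` is the set where
`|(L x) i| ≤ 2 * deg i * ξ` for all `i`. Hence outside `P(D, E) + ν` the Dirichlet energy `xᵀ L x`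
decreases at a rate proportional to `𝒱(x)²`; being itself at most a multiple of `𝒱(x)²`, it forces
`𝒱` to drop by the factor `γ` in bounded time. On every graph the largest component cannot increase
and the smallest cannot decrease, so `𝒱` is nonincreasing across the switches. A recurrent graph is
active during whole dwell times at arbitrarily late times, so `𝒱` decays geometrically until it
reaches the tube of that graph, where it stays.
-/

open scoped Matrix

section Spread

variable {n : ℕ}

theorem abs_sub_le_spread (x : Fin n → ℝ) (i j : Fin n) : |x i - x j| ≤ spread x :=
  have sub_le (i j : Fin n) : x i - x j ≤ spread x :=
    sub_le_sub (le_ciSup (Set.finite_range x).bddAbove i)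
      (ciInf_le (Set.finite_range x).bddBelow j)
  abs_sub_le_iff.2 ⟨sub_le i j, sub_le j i⟩

variable [Nonempty (Fin n)]

theorem exists_spread_eq_sub (x : Fin n → ℝ) : ∃ i j, spread x = x i - x j := by
  obtain ⟨i, hi⟩ := exists_eq_ciSup_of_finite (f := x)
  obtain ⟨j, hj⟩ := exists_eq_ciInf_of_finite (f := x)
  exact ⟨i, j, by rw [spread, hi, hj]⟩

theorem spread_le_of_forall_sub_le {x : Fin n → ℝ} {c : ℝ} (h : ∀ i j, x i - x j ≤ c) :
    spread x ≤ c := by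
  obtain ⟨i, j, hij⟩ := exists_spread_eq_sub x
  exact hij ▸ h i j

theorem spread_nonneg (x : Fin n → ℝ) : 0 ≤ spread x :=
  let i := Classical.arbitrary (Fin n)
  (abs_nonneg _).trans (abs_sub_le_spread x i i)

theorem spread_sub_const (x : Fin n → ℝ) (c : ℝ) : spread (fun i => x i - c) = spread x := by
  refine le_antisymm (spread_le_of_forall_sub_le fun i j => ?_)
    (spread_le_of_forall_sub_le fun i j => ?_)
  · simpa using (le_abs_self _).trans (abs_sub_le_spread x i j)
  · simpa using (le_abs_self _).trans (abs_sub_le_spread (fun i => x i - c) i j)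

theorem spread_le_spread_add (x y : Fin n → ℝ) : spread x ≤ spread y + 2 * ‖x - y‖ := by
  refine spread_le_of_forall_sub_le fun i j => ?_
  have hi : x i - y i ≤ ‖x - y‖ := (le_abs_self _).trans (norm_le_pi_norm (x - y) i)
  have hj : -(x j - y j) ≤ ‖x - y‖ := (neg_le_abs _).trans (norm_le_pi_norm (x - y) j)
  linarith [le_of_abs_le (abs_sub_le_spread y i j)]

theorem continuous_spread : Continuous (spread : (Fin n → ℝ) → ℝ) :=
  (LipschitzWith.of_le_add_mul 2 fun x y => by
    simpa [dist_eq_norm] using spread_le_spread_add x y).continuous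

end Spread

section Laplacian

variable {V : Type*} [Fintype V] [DecidableEq V] (G : SimpleGraph V) [DecidableRel G.Adj]

/-- The Dirichlet energy `xᵀ L x` of `x`, where `L` is the Laplacian of `G`: the sum over the edges
of the squared differences. It is the Lyapunov function of the fixed-topology dynamics. -/
def dirichletEnergy (x : V → ℝ) : ℝ :=
  x ⬝ᵥ G.lapMatrix ℝ *ᵥ x

theorem lapMatrix_mulVec_apply_eq_sum (x : V → ℝ) (i : V) :
    (G.lapMatrix ℝ *ᵥ x) i = ∑ j ∈ G.neighborFinset i, (x i - x j) := by
  simp [SimpleGraph.lapMatrix_mulVec_apply]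

theorem lapMatrix_mulVec_const (c : ℝ) : (G.lapMatrix ℝ *ᵥ fun _ => c) = 0 := by
  ext i
  simp [lapMatrix_mulVec_apply_eq_sum]

theorem lapMatrix_mulVec_sub_const (x : V → ℝ) (c : ℝ) :
    (G.lapMatrix ℝ *ᵥ fun i => x i - c) = G.lapMatrix ℝ *ᵥ x := by
  ext i
  simp [lapMatrix_mulVec_apply_eq_sum]

theorem dirichletEnergy_eq_sum (x : V → ℝ) :
    dirichletEnergy G x = (∑ i, ∑ j, if G.Adj i j then (x i - x j) ^ 2 else 0) / 2 := by
  rw [dirichletEnergy, ← Matrix.toLinearMap₂'_apply', G.lapMatrix_toLinearMap₂' ℝ]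

theorem dirichletEnergy_nonneg (x : V → ℝ) : 0 ≤ dirichletEnergy G x := by
  rw [dirichletEnergy_eq_sum]
  positivity

theorem sq_sub_le_dirichletEnergy (x : V → ℝ) {i j : V} (hij : G.Adj i j) :
    (x i - x j) ^ 2 ≤ 2 * dirichletEnergy G x := by
  let f : V → V → ℝ := fun i j => if G.Adj i j then (x i - x j) ^ 2 else 0
  have hf : ∀ i j, 0 ≤ f i j := fun i j => by positivity
  calc (x i - x j) ^ 2 = f i j := (if_pos hij).symm
    _ ≤ ∑ j, f i j := Finset.single_le_sum (fun j _ => hf i j) (Finset.mem_univ j)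
    _ ≤ ∑ i, ∑ j, f i j :=
      Finset.single_le_sum (f := fun i => ∑ j, f i j)
        (fun i _ => Finset.sum_nonneg fun j _ => hf i j) (Finset.mem_univ i)
    _ = 2 * dirichletEnergy G x := by rw [dirichletEnergy_eq_sum]; ring

theorem dirichletEnergy_eq_sub_const_dotProduct (x : V → ℝ) (c : ℝ) :
    dirichletEnergy G x = (fun i => x i - c) ⬝ᵥ G.lapMatrix ℝ *ᵥ x := by
  rw [dirichletEnergy, Matrix.dotProduct_mulVec, Matrix.dotProduct_mulVec,
    ← Matrix.mulVec_transpose, ← Matrix.mulVec_transpose, (G.isSymm_lapMatrix ℝ).eq,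
    lapMatrix_mulVec_sub_const]

theorem continuous_dirichletEnergy : Continuous (dirichletEnergy G) := by
  unfold dirichletEnergy
  fun_prop

end Laplacian

theorem abs_sub_le_length_mul {V : Type*} {G : SimpleGraph V} {x : V → ℝ} {M : ℝ}
    (hM : ∀ i j, G.Adj i j → |x i - x j| ≤ M) {i j : V} (p : G.Walk i j) :
    |x i - x j| ≤ p.length * M := by
  induction p with
  | nil => simp
  | @cons u v w huv p ih =>
    calc |x u - x w| ≤ |x u - x v| + |x v - x w| := abs_sub_le _ _ _
      _ ≤ M + p.length * M := add_le_add (hM u v huv) ih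
      _ = (p.cons huv).length * M := by rw [SimpleGraph.Walk.length_cons]; push_cast; ring

section SpectralBounds

variable {n : ℕ} (G : SimpleGraph (Fin n)) [DecidableRel G.Adj]

theorem dirichletEnergy_le_sq_spread (x : Fin n → ℝ) :
    dirichletEnergy G x ≤ (n : ℝ) ^ 2 / 2 * spread x ^ 2 := by
  have hterm : ∀ i j, (if G.Adj i j then (x i - x j) ^ 2 else 0) ≤ spread x ^ 2 := fun i j => by
    split_ifs
    · exact sq_le_sq' (neg_le_of_abs_le (abs_sub_le_spread x i j))
        (le_of_abs_le (abs_sub_le_spread x i j))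
    · positivity
  calc dirichletEnergy G x ≤ (∑ _i : Fin n, ∑ _j : Fin n, spread x ^ 2) / 2 := by
        rw [dirichletEnergy_eq_sum]
        gcongr with i _ j _
        exact hterm i j
    _ = (n : ℝ) ^ 2 / 2 * spread x ^ 2 := by simp; ring

variable {G}

theorem sq_spread_le_dirichletEnergy (hG : G.Connected) (x : Fin n → ℝ) :
    spread x ^ 2 ≤ 2 * (n : ℝ) ^ 2 * dirichletEnergy G x := by
  have := hG.nonempty
  obtain ⟨i, j, hij⟩ := exists_spread_eq_sub x
  obtain ⟨p, hp⟩ := (hG.preconnected i j).exists_isPath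
  have hlen : (p.length : ℝ) ≤ n := by
    exact_mod_cast hp.length_lt.le.trans_eq (Fintype.card_fin n)
  have hedge : ∀ i j, G.Adj i j → |x i - x j| ≤ √(2 * dirichletEnergy G x) := fun i j h =>
    Real.abs_le_sqrt (sq_sub_le_dirichletEnergy G x h)
  have hspread : spread x ≤ n * √(2 * dirichletEnergy G x) :=
    calc spread x ≤ |x i - x j| := hij ▸ le_abs_self _
      _ ≤ p.length * √(2 * dirichletEnergy G x) := abs_sub_le_length_mul hedge p
      _ ≤ n * √(2 * dirichletEnergy G x) := by gcongr
  calc spread x ^ 2 ≤ (n * √(2 * dirichletEnergy G x)) ^ 2 :=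
        pow_le_pow_left₀ (spread_nonneg x) hspread 2
    _ = 2 * (n : ℝ) ^ 2 * dirichletEnergy G x := by
      rw [mul_pow, Real.sq_sqrt (mul_nonneg zero_le_two (dirichletEnergy_nonneg G x))]
      ring

theorem dirichletEnergy_le_spread_mul_norm [Nonempty (Fin n)] (x : Fin n → ℝ) :
    dirichletEnergy G x ≤ n * (spread x * ‖G.lapMatrix ℝ *ᵥ x‖) := by
  let i₀ := Classical.arbitrary (Fin n)
  calc dirichletEnergy G x = ∑ i, (x i - x i₀) * (G.lapMatrix ℝ *ᵥ x) i :=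
        dirichletEnergy_eq_sub_const_dotProduct G x (x i₀)
    _ ≤ ∑ _i : Fin n, spread x * ‖G.lapMatrix ℝ *ᵥ x‖ := by
        refine Finset.sum_le_sum fun i _ => (le_abs_self _).trans ?_
        rw [abs_mul]
        exact mul_le_mul (abs_sub_le_spread x i i₀) (norm_le_pi_norm (G.lapMatrix ℝ *ᵥ x) i)
          (abs_nonneg _) (spread_nonneg x)
    _ = n * (spread x * ‖G.lapMatrix ℝ *ᵥ x‖) := by simp

theorem spread_le_norm_lapMatrix_mulVec (hG : G.Connected) (x : Fin n → ℝ) :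
    spread x ≤ 2 * (n : ℝ) ^ 3 * ‖G.lapMatrix ℝ *ᵥ x‖ := by
  have := hG.nonempty
  rcases (spread_nonneg x).eq_or_lt with hV | hV
  · rw [← hV]
    positivity
  refine le_of_mul_le_mul_right ?_ hV
  calc spread x * spread x = spread x ^ 2 := (sq _).symm
    _ ≤ 2 * (n : ℝ) ^ 2 * dirichletEnergy G x := sq_spread_le_dirichletEnergy hG x
    _ ≤ 2 * (n : ℝ) ^ 2 * (n * (spread x * ‖G.lapMatrix ℝ *ᵥ x‖)) := by
      gcongr
      exact dirichletEnergy_le_spread_mul_norm x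
    _ = 2 * (n : ℝ) ^ 3 * ‖G.lapMatrix ℝ *ᵥ x‖ * spread x := by ring

end SpectralBounds

section LazyControl

variable {n : ℕ} {G : SimpleGraph (Fin n)} [DecidableRel G.Adj] {ξ : ℝ} {d : Fin n → Fin n → ℝ}
  {x v : Fin n → ℝ} {i : Fin n}

theorem nbrs_eq_neighborFinset : nbrs G i = G.neighborFinset i := by
  ext j
  simp [nbrs]

theorem abs_sum_disturbance_le (hd : d ∈ disturbanceBox n ξ) :
    |∑ j ∈ G.neighborFinset i, d i j| ≤ G.degree i * ξ := by
  rw [← G.card_neighborFinset_eq_degree, ← nsmul_eq_mul]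
  exact (Finset.abs_sum_le_sum_abs _ _).trans
    (Finset.sum_le_card_nsmul _ _ ξ fun j _ => abs_le.2 (hd i j))

theorem IsLazyEstimate.abs_sum_sub_le {N : Finset (Fin n)} {xi : ℝ} {y z : Fin n → ℝ}
    (hz : IsLazyEstimate N ξ xi y z) :
    |∑ j ∈ N, (z j - xi) - ∑ j ∈ N, (y j - xi)| ≤ N.card * ξ := by
  rw [← Finset.sum_sub_distrib, ← nsmul_eq_mul]
  refine (Finset.abs_sum_le_sum_abs _ _).trans (Finset.sum_le_card_nsmul _ _ ξ fun j hj => ?_)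
  rw [sub_sub_sub_cancel_right, abs_sub_le_iff]
  constructor <;> linarith [(hz.1 j hj).1, (hz.1 j hj).2]

/-- Shifting all the measures by the same amount reaches every sum in the range of the estimates. -/
theorem IsLazyEstimate.abs_sum_le {N : Finset (Fin n)} {xi : ℝ} {y z : Fin n → ℝ}
    (hz : IsLazyEstimate N ξ xi y z) {r : ℝ} (hr : |r - ∑ j ∈ N, (y j - xi)| ≤ N.card * ξ) :
    |∑ j ∈ N, (z j - xi)| ≤ |r| := by
  rcases N.eq_empty_or_nonempty with rfl | hN
  · simp
  have hcard : (0 : ℝ) < N.card := by exact_mod_cast hN.card_pos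
  set e : ℝ := (r - ∑ j ∈ N, (y j - xi)) / N.card with he
  have he_le : |e| ≤ ξ := by
    rwa [he, abs_div, abs_of_pos hcard, div_le_iff₀' hcard]
  have hshift : (fun j => y j + e) ∈ candidateEstimates N ξ y := fun j _ =>
    ⟨by linarith [neg_le_of_abs_le he_le], by linarith [le_of_abs_le he_le]⟩
  have hsum : ∑ j ∈ N, (y j + e - xi) = r := by
    simp only [add_sub_right_comm _ e, Finset.sum_add_distrib, Finset.sum_const, nsmul_eq_mul]
    rw [he, mul_div_cancel₀ _ hcard.ne']
    ring
  exact hsum ▸ isMinOn_iff.1 hz.2 _ hshift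

theorem sum_measures_sub_eq :
    ∑ j ∈ G.neighborFinset i, (x j + d i j - x i) =
      ∑ j ∈ G.neighborFinset i, d i j - (G.lapMatrix ℝ *ᵥ x) i := by
  rw [lapMatrix_mulVec_apply_eq_sum, ← Finset.sum_sub_distrib]
  exact Finset.sum_congr rfl fun j _ => by ring

theorem IsLazyControl.abs_sub_le (hv : IsLazyControl G ξ d x v) (i : Fin n) :
    |v i - (∑ j ∈ G.neighborFinset i, d i j - (G.lapMatrix ℝ *ᵥ x) i)| ≤ G.degree i * ξ := by
  obtain ⟨z, hz, hvz⟩ := hv i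
  rw [nbrs_eq_neighborFinset] at hz hvz
  rw [hvz, ← sum_measures_sub_eq, ← G.card_neighborFinset_eq_degree]
  exact hz.abs_sum_sub_le

theorem IsLazyControl.abs_le_abs (hv : IsLazyControl G ξ d x v) {i : Fin n} {r : ℝ}
    (hr : |r - (∑ j ∈ G.neighborFinset i, d i j - (G.lapMatrix ℝ *ᵥ x) i)| ≤ G.degree i * ξ) :
    |v i| ≤ |r| := by
  obtain ⟨z, hz, hvz⟩ := hv i
  rw [nbrs_eq_neighborFinset] at hz hvz
  rw [← sum_measures_sub_eq, ← G.card_neighborFinset_eq_degree] at hr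
  exact hvz ▸ hz.abs_sum_le hr

theorem IsLazyControl.abs_le_abs_lapMatrix_mulVec (hv : IsLazyControl G ξ d x v)
    (hd : d ∈ disturbanceBox n ξ) (i : Fin n) : |v i| ≤ |(G.lapMatrix ℝ *ᵥ x) i| := by
  rw [← abs_neg ((G.lapMatrix ℝ *ᵥ x) i)]
  refine hv.abs_le_abs ?_
  rw [neg_sub_left, sub_add_cancel, abs_neg]
  exact abs_sum_disturbance_le hd

theorem IsLazyControl.abs_add_lapMatrix_mulVec_le (hv : IsLazyControl G ξ d x v)
    (hd : d ∈ disturbanceBox n ξ) (i : Fin n) :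
    |v i + (G.lapMatrix ℝ *ᵥ x) i| ≤ 2 * G.degree i * ξ := by
  have hdist := abs_le.1 (abs_sum_disturbance_le (G := G) (i := i) hd)
  have hcontrol := abs_le.1 (hv.abs_sub_le i)
  exact abs_le.2 ⟨by linarith, by linarith⟩

theorem IsLazyControl.mul_lapMatrix_mulVec_nonpos (hv : IsLazyControl G ξ d x v)
    (hd : d ∈ disturbanceBox n ξ) (i : Fin n) : v i * (G.lapMatrix ℝ *ᵥ x) i ≤ 0 := by
  by_contra! hpos
  have hdist := abs_le.1 (abs_sum_disturbance_le (G := G) (i := i) hd)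
  have hcontrol := abs_le.1 (hv.abs_sub_le i)
  have hv0 : |v i| ≤ |0| := hv.abs_le_abs <| abs_le.2 <| by
    rcases pos_and_pos_or_neg_and_neg_of_mul_pos hpos with h | h <;> constructor <;> linarith
  rw [abs_zero, abs_nonpos_iff] at hv0
  simp [hv0] at hpos

theorem IsLazyControl.dotProduct_lapMatrix_mulVec_le (hv : IsLazyControl G ξ d x v)
    (hd : d ∈ disturbanceBox n ξ) {η : ℝ} (hη : 0 ≤ η)
    (hi : 2 * G.degree i * ξ + η ≤ |(G.lapMatrix ℝ *ᵥ x) i|) :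
    v ⬝ᵥ G.lapMatrix ℝ *ᵥ x ≤ -η ^ 2 := by
  set l := (G.lapMatrix ℝ *ᵥ x) i
  have hvl : |v i + l| ≤ 2 * G.degree i * ξ := hv.abs_add_lapMatrix_mulVec_le hd i
  calc v ⬝ᵥ G.lapMatrix ℝ *ᵥ x ≤ v i * l := by
        have := Finset.single_le_sum (fun j _ => neg_nonneg.2 (hv.mul_lapMatrix_mulVec_nonpos hd j))
          (Finset.mem_univ i)
        rwa [Finset.sum_neg_distrib, neg_le_neg_iff] at this
    _ = (v i + l) * l - |l| * |l| := by rw [abs_mul_abs_self]; ring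
    _ ≤ 2 * G.degree i * ξ * |l| - |l| * |l| := by
        refine sub_le_sub_right ((le_abs_self _).trans ?_) _
        rw [abs_mul]
        gcongr
    _ = -((|l| - 2 * G.degree i * ξ) * |l|) := by ring
    _ ≤ -(η * η) := by
        have hM := (abs_nonneg _).trans hvl
        exact neg_le_neg (mul_le_mul (by linarith) (by linarith) hη (by linarith))
    _ = -η ^ 2 := by ring

end LazyControl

section ExtremalAgents

variable {n : ℕ} {G : SimpleGraph (Fin n)} {ξ : ℝ} {d : Fin n → Fin n → ℝ} {x v : Fin n → ℝ}
  {i : Fin n}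

theorem IsLazyControl.nonpos_of_forall_le (hv : IsLazyControl G ξ d x v)
    (hd : d ∈ disturbanceBox n ξ) (hi : ∀ j, x j ≤ x i) : v i ≤ 0 := by
  classical
  have hlap : 0 ≤ (G.lapMatrix ℝ *ᵥ x) i := by
    rw [lapMatrix_mulVec_apply_eq_sum]
    exact Finset.sum_nonneg fun j _ => sub_nonneg.2 (hi j)
  rcases hlap.eq_or_lt with h0 | hpos
  · have := hv.abs_le_abs_lapMatrix_mulVec hd i
    rw [← h0, abs_zero, abs_nonpos_iff] at this
    exact this.le
  · exact nonpos_of_mul_nonpos_left (hv.mul_lapMatrix_mulVec_nonpos hd i) hpos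

theorem IsLazyControl.nonneg_of_forall_ge (hv : IsLazyControl G ξ d x v)
    (hd : d ∈ disturbanceBox n ξ) (hi : ∀ j, x i ≤ x j) : 0 ≤ v i := by
  classical
  have hlap : (G.lapMatrix ℝ *ᵥ x) i ≤ 0 := by
    rw [lapMatrix_mulVec_apply_eq_sum]
    exact Finset.sum_nonpos fun j _ => sub_nonpos.2 (hi j)
  rcases hlap.eq_or_lt with h0 | hneg
  · have := hv.abs_le_abs_lapMatrix_mulVec hd i
    rw [h0, abs_zero, abs_nonpos_iff] at this
    exact this.ge
  · by_contra! hv0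
    exact (mul_pos_of_neg_of_neg hv0 hneg).not_ge (hv.mul_lapMatrix_mulVec_nonpos hd i)

end ExtremalAgents

section Polyhedron

variable {n : ℕ} {G : SimpleGraph (Fin n)} [DecidableRel G.Adj] {ξ : ℝ}

theorem mem_polyP_iff (hdeg : ∀ i, 0 < G.degree i) {d : Fin n → Fin n → ℝ} {x : Fin n → ℝ} :
    x ∈ polyP ξ d G ↔
      ∀ i, |(G.lapMatrix ℝ *ᵥ x) i - ∑ j ∈ G.neighborFinset i, d i j| ≤ G.degree i * ξ := by
  refine forall_congr' fun i => ?_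
  have hpos : (0 : ℝ) < G.degree i := by exact_mod_cast hdeg i
  have havg : (∑ j ∈ G.neighborFinset i, x j) / G.degree i - x i =
      -((G.lapMatrix ℝ *ᵥ x) i / G.degree i) := by
    rw [SimpleGraph.lapMatrix_mulVec_apply]
    field_simp
    ring
  rw [nbrs_eq_neighborFinset, G.card_neighborFinset_eq_degree, havg, ← div_le_iff₀' hpos,
    ← abs_of_pos hpos, ← abs_div, abs_of_pos hpos, sub_div, abs_sub_le_iff]
  constructor <;> rintro ⟨h₁, h₂⟩ <;> constructor <;> linarith

theorem mem_setP_iff (hdeg : ∀ i, 0 < G.degree i) {x : Fin n → ℝ} :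
    x ∈ setP ξ (disturbanceBox n ξ) G ↔
      ∀ i, |(G.lapMatrix ℝ *ᵥ x) i| ≤ 2 * G.degree i * ξ := by
  simp only [setP, Set.mem_iUnion₂, exists_prop, mem_polyP_iff hdeg]
  constructor
  · rintro ⟨d, hd, h⟩ i
    calc |(G.lapMatrix ℝ *ᵥ x) i|
        ≤ |(G.lapMatrix ℝ *ᵥ x) i - ∑ j ∈ G.neighborFinset i, d i j|
          + |∑ j ∈ G.neighborFinset i, d i j| := by
          simpa using abs_add_le ((G.lapMatrix ℝ *ᵥ x) i - ∑ j ∈ G.neighborFinset i, d i j)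
            (∑ j ∈ G.neighborFinset i, d i j)
      _ ≤ G.degree i * ξ + G.degree i * ξ := add_le_add (h i) (abs_sum_disturbance_le hd)
      _ = 2 * G.degree i * ξ := by ring
  · intro h
    have hpos : ∀ i, (0 : ℝ) < G.degree i := fun i => by exact_mod_cast hdeg i
    refine ⟨fun i _ => (G.lapMatrix ℝ *ᵥ x) i / (2 * G.degree i), fun i _ => ?_, fun i => ?_⟩
    · have hi : (0 : ℝ) < 2 * G.degree i := mul_pos two_pos (hpos i)
      rw [← abs_le, abs_div, abs_of_pos hi, div_le_iff₀' hi]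
      exact h i
    · have hhalf : (G.lapMatrix ℝ *ᵥ x) i
          - ∑ _j ∈ G.neighborFinset i, (G.lapMatrix ℝ *ᵥ x) i / (2 * G.degree i) =
          (G.lapMatrix ℝ *ᵥ x) i / 2 := by
        have := (hpos i).ne'
        rw [Finset.sum_const, G.card_neighborFinset_eq_degree, nsmul_eq_mul]
        field_simp
        ring
      rw [hhalf, abs_div, abs_two]
      linarith [h i]

theorem const_mem_setP (hdeg : ∀ i, 0 < G.degree i) (hξ : 0 ≤ ξ) (c : ℝ) :
    (fun _ => c) ∈ setP ξ (disturbanceBox n ξ) G := by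
  refine (mem_setP_iff hdeg).2 fun i => ?_
  rw [lapMatrix_mulVec_const, Pi.zero_apply, abs_zero]
  positivity

theorem isClosed_setP (hdeg : ∀ i, 0 < G.degree i) :
    IsClosed (setP ξ (disturbanceBox n ξ) G) := by
  have hsetP : setP ξ (disturbanceBox n ξ) G =
      ⋂ i, {x | |(G.lapMatrix ℝ *ᵥ x) i| ≤ 2 * G.degree i * ξ} := by
    ext x
    simp [mem_setP_iff hdeg]
  rw [hsetP]
  exact isClosed_iInter fun i => isClosed_le (by fun_prop) continuous_const

theorem degree_le (i : Fin n) : G.degree i ≤ n :=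
  (G.degree_lt_card_verts i).le.trans_eq (Fintype.card_fin n)

theorem spread_le_of_abs_lapMatrix_mulVec_le (hG : G.Connected) (hξ : 0 ≤ ξ) {η : ℝ} (hη : 0 ≤ η)
    {x : Fin n → ℝ} (hx : ∀ i, |(G.lapMatrix ℝ *ᵥ x) i| ≤ 2 * G.degree i * ξ + η) :
    spread x ≤ 2 * (n : ℝ) ^ 3 * (2 * n * ξ + η) := by
  refine (spread_le_norm_lapMatrix_mulVec hG x).trans ?_
  gcongr
  refine (pi_norm_le_iff_of_nonneg (by positivity)).2 fun i => (hx i).trans ?_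
  gcongr
  exact degree_le i

variable [Nonempty (Fin n)]

theorem image_spread_setP_eq (hdeg : ∀ i, 0 < G.degree i) {R : ℝ}
    (hR : ∀ x ∈ setP ξ (disturbanceBox n ξ) G, spread x ≤ R) :
    spread '' setP ξ (disturbanceBox n ξ) G =
      spread '' (setP ξ (disturbanceBox n ξ) G ∩ Metric.closedBall 0 R) := by
  refine (Set.image_mono Set.inter_subset_left).antisymm' ?_
  rintro _ ⟨x, hx, rfl⟩
  let i₀ := Classical.arbitrary (Fin n)
  refine ⟨fun i => x i - x i₀, ⟨(mem_setP_iff hdeg).2 ?_, ?_⟩, spread_sub_const x (x i₀)⟩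
  · rw [lapMatrix_mulVec_sub_const]
    exact (mem_setP_iff hdeg).1 hx
  · rw [mem_closedBall_zero_iff, pi_norm_le_iff_of_nonneg ((spread_nonneg x).trans (hR x hx))]
    exact fun i => (abs_sub_le_spread x i i₀).trans (hR x hx)

theorem mem_fatten_setP_of_spread_le (hdeg : ∀ i, 0 < G.degree i) (hξ : 0 ≤ ξ) {ν : ℝ}
    {x : Fin n → ℝ} (hx : spread x ≤ ν) : x ∈ fatten (setP ξ (disturbanceBox n ξ) G) ν := by
  let i₀ := Classical.arbitrary (Fin n)
  refine ⟨fun _ => x i₀, const_mem_setP hdeg hξ _, ?_⟩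
  exact (pi_norm_le_iff_of_nonneg ((spread_nonneg x).trans hx)).2 fun i =>
    (abs_sub_le_spread x i i₀).trans hx

/-- A nearby point of `P(D, E)` is found by contracting `x` towards a constant vector. -/
theorem mem_fatten_setP_of_abs_le (hdeg : ∀ i, 0 < G.degree i) (hξ : 0 ≤ ξ) {η ν : ℝ} (hη : 0 ≤ η)
    (hν : 0 ≤ ν) {x : Fin n → ℝ} (hx : ∀ i, |(G.lapMatrix ℝ *ᵥ x) i| ≤ 2 * G.degree i * ξ + η)
    (hην : η * spread x ≤ 2 * ξ * ν) : x ∈ fatten (setP ξ (disturbanceBox n ξ) G) ν := by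
  rcases le_or_gt (spread x) ν with hV | hV
  · exact mem_fatten_setP_of_spread_le hdeg hξ hV
  have hV0 : 0 < spread x := hν.trans_lt hV
  let i₀ := Classical.arbitrary (Fin n)
  set r := ν / spread x with hr
  have hr0 : 0 ≤ r := by positivity
  have hr1 : r ≤ 1 := div_le_one_of_le₀ hV.le hV0.le
  have hηr : η ≤ 2 * ξ * r := by rwa [hr, ← mul_div_assoc, le_div_iff₀ hV0]
  refine ⟨(1 - r) • (fun i => x i - x i₀) + fun _ => x i₀, (mem_setP_iff hdeg).2 fun i => ?_, ?_⟩
  · have hdeg1 : (1 : ℝ) ≤ G.degree i := by exact_mod_cast hdeg i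
    rw [Matrix.mulVec_add, Matrix.mulVec_smul, lapMatrix_mulVec_const, lapMatrix_mulVec_sub_const,
      add_zero, Pi.smul_apply, smul_eq_mul, abs_mul, abs_of_nonneg (sub_nonneg.2 hr1)]
    calc (1 - r) * |(G.lapMatrix ℝ *ᵥ x) i|
        ≤ (1 - r) * (2 * G.degree i * ξ + η) :=
          mul_le_mul_of_nonneg_left (hx i) (sub_nonneg.2 hr1)
      _ = (1 - r) * (2 * G.degree i * ξ) + η - r * η := by ring
      _ ≤ (1 - r) * (2 * G.degree i * ξ) + 2 * ξ * r :=
          (sub_le_self _ (mul_nonneg hr0 hη)).trans (by gcongr)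
      _ = 2 * G.degree i * ξ - (G.degree i - 1) * (2 * ξ * r) := by ring
      _ ≤ 2 * G.degree i * ξ :=
          sub_le_self _ (mul_nonneg (sub_nonneg.2 hdeg1) (by positivity))
  · refine (pi_norm_le_iff_of_nonneg hν).2 fun i => ?_
    have hcoord : x i - ((1 - r) * (x i - x i₀) + x i₀) = r * (x i - x i₀) := by ring
    calc |x i - ((1 - r) * (x i - x i₀) + x i₀)| = r * |x i - x i₀| := by
          rw [hcoord, abs_mul, abs_of_nonneg hr0]
      _ ≤ r * spread x := mul_le_mul_of_nonneg_left (abs_sub_le_spread x i i₀) hr0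
      _ = ν := div_mul_cancel₀ ν hV0.ne'

end Polyhedron

section ConnectedPolyhedron

variable {n : ℕ} [Nontrivial (Fin n)] {G : SimpleGraph (Fin n)} {ξ : ℝ}

theorem exists_excess_of_notMem_fatten_setP [DecidableRel G.Adj] (hG : G.Connected) (hξ : 0 ≤ ξ)
    {ν : ℝ} (hν : 0 < ν) :
    ∃ δ > 0, ∀ x ∉ fatten (setP ξ (disturbanceBox n ξ) G) ν,
      ∃ i, 2 * G.degree i * ξ + δ * spread x ≤ |(G.lapMatrix ℝ *ᵥ x) i| := by
  have hn : (0 : ℝ) < n := by exact_mod_cast Fin.pos_iff_nonempty.2 hG.nonempty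
  have hdeg : ∀ i, 0 < G.degree i := fun i => hG.preconnected.degree_pos_of_nontrivial i
  -- If all the excesses are smaller than `δ * spread x`, then `hδn` gives `spread x ≤ R` with
  -- `R = 8 * n ^ 4 * ξ`, and `hδξ` is `δ * R ^ 2 ≤ 2 * ξ * ν`.
  set D : ℝ := 4 * n ^ 3 * ν + 32 * n ^ 8 * ξ with hD
  have hD0 : 0 < D := by positivity
  have hδ : 0 < ν / D := by positivity
  have hδn : ν / D * (4 * n ^ 3) ≤ 1 := by
    rw [div_mul_eq_mul_div, div_le_one hD0, hD]
    linarith [show 0 ≤ 32 * n ^ 8 * ξ by positivity]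
  have hδξ : ν / D * (32 * n ^ 8 * ξ) ≤ ν := by
    rw [div_mul_eq_mul_div, div_le_iff₀ hD0, hD]
    exact mul_le_mul_of_nonneg_left (by linarith [show 0 ≤ 4 * n ^ 3 * ν by positivity]) hν.le
  refine ⟨ν / D, hδ, fun x hx => ?_⟩
  generalize ν / D = δ at hδ hδn hδξ ⊢
  by_contra! hle
  have hV := spread_nonneg x
  have hVξ : spread x ≤ 8 * n ^ 4 * ξ := by
    have h := spread_le_of_abs_lapMatrix_mulVec_le hG hξ (by positivity) fun i => (hle i).le
    have hδV := mul_le_mul_of_nonneg_right hδn hV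
    linarith
  refine hx (mem_fatten_setP_of_abs_le hdeg hξ (by positivity) hν.le (fun i => (hle i).le) ?_)
  calc δ * spread x * spread x ≤ δ * (8 * n ^ 4 * ξ) * (8 * n ^ 4 * ξ) := by gcongr
    _ = 2 * ξ * (δ * (32 * n ^ 8 * ξ)) := by ring
    _ ≤ 2 * ξ * ν := by gcongr

theorem isGreatest_maxSpread (hG : G.Connected) (hξ : 0 ≤ ξ) :
    IsGreatest (spread '' setP ξ (disturbanceBox n ξ) G) (maxSpread ξ (disturbanceBox n ξ) G) := by
  classical
  have hdeg : ∀ i, 0 < G.degree i := fun i => hG.preconnected.degree_pos_of_nontrivial i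
  have hbound : ∀ x ∈ setP ξ (disturbanceBox n ξ) G, spread x ≤ 2 * n ^ 3 * (2 * n * ξ + 0) :=
    fun x hx => spread_le_of_abs_lapMatrix_mulVec_le hG hξ le_rfl <| by
      simpa using (mem_setP_iff hdeg).1 hx
  have hcompact : IsCompact (spread '' setP ξ (disturbanceBox n ξ) G) := by
    rw [image_spread_setP_eq hdeg hbound]
    exact ((isCompact_closedBall _ _).inter_left (isClosed_setP hdeg)).image continuous_spread
  exact hcompact.isGreatest_sSup ⟨_, Set.mem_image_of_mem _ (const_mem_setP hdeg hξ 0)⟩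

theorem maxSpread_nonneg (hG : G.Connected) (hξ : 0 ≤ ξ) :
    0 ≤ maxSpread ξ (disturbanceBox n ξ) G := by
  obtain ⟨x, -, hx⟩ := (isGreatest_maxSpread hG hξ).1
  exact hx ▸ spread_nonneg x

end ConnectedPolyhedron

section MaximumPrinciple

variable {ι : Type*} [Finite ι]

theorem eventually_lt_add_mul_of_hasDerivAt {f : ℝ → ℝ} {f' c ε t : ℝ} (hf : HasDerivAt f f' t)
    (hfc : f t ≤ c) (h : f t = c → f' < ε) : ∀ᶠ s in 𝓝[>] t, f s < c + ε * (s - t) := by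
  rcases hfc.eq_or_lt with heq | hlt
  · have hslope := (hf.tendsto_slope.mono_left (nhdsGT_le_nhdsNE t)).eventually_lt_const (h heq)
    filter_upwards [hslope, self_mem_nhdsWithin] with s hs (hts : t < s)
    rw [slope_def_field, div_lt_iff₀ (sub_pos.2 hts)] at hs
    linarith
  · have hcont : ContinuousAt (fun s => f s - ε * (s - t)) t :=
      hf.continuousAt.sub (by fun_prop)
    have hev := hcont.eventually_lt continuousAt_const (show f t - ε * (t - t) < c by simpa)
    filter_upwards [hev.filter_mono nhdsWithin_le_nhds] with s hs
    linarith

theorem le_add_mul_of_hasDerivAt_of_isMax {x : ℝ → ι → ℝ} {a b c ε : ℝ}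
    (hx : ContinuousOn x (Set.Icc a b))
    (hder : ∀ t ∈ Set.Ioo a b, ∃ v, HasDerivAt x v t ∧ ∀ i, (∀ j, x t j ≤ x t i) → v i ≤ 0)
    (hc : ∀ i, x a i ≤ c) (hε : 0 < ε) {t : ℝ} (ht : t ∈ Set.Icc a b) (i : ι) :
    x t i ≤ c + ε * (1 + (t - a)) := by
  let S : Set ℝ := {t | ∀ i, x t i ≤ c + ε * (1 + (t - a))}
  suffices hS : Set.Icc a b ⊆ S from hS ht i
  have hclosed : IsClosed (S ∩ Set.Icc a b) := by
    have hS : S ∩ Set.Icc a b =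
        {t ∈ Set.Icc a b | x t ≤ fun _ => c + ε * (1 + (t - a))} := by
      ext t
      exact and_comm
    rw [hS]
    exact isClosed_Icc.isClosed_le hx (by fun_prop)
  refine hclosed.Icc_subset_of_forall_mem_nhdsWithin (fun i => ?_) fun t ⟨htS, hta, htb⟩ => ?_
  · rw [sub_self, add_zero, mul_one]
    linarith [hc i]
  refine (eventually_all.2 fun i => ?_ : ∀ᶠ s in 𝓝[>] t, ∀ i, x s i ≤ c + ε * (1 + (s - a)))
  rcases hta.eq_or_lt with rfl | hta
  · have hcont : ContinuousWithinAt (fun s => x s i) (Set.Ioi a) a :=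
      ((continuousWithinAt_pi.1 (hx a ⟨le_rfl, htb.le⟩) i).mono_of_mem_nhdsWithin
        (Icc_mem_nhdsGT htb))
    filter_upwards [hcont.eventually_lt_const ((hc i).trans_lt (lt_add_of_pos_right c hε)),
      self_mem_nhdsWithin] with s hs (has : a < s)
    nlinarith
  · obtain ⟨v, hv, hmax⟩ := hder t ⟨hta, htb⟩
    have hvi : x t i = c + ε * (1 + (t - a)) → v i < ε := fun h =>
      (hmax i fun j => (htS j).trans_eq h.symm).trans_lt hε
    filter_upwards [eventually_lt_add_mul_of_hasDerivAt (hasDerivAt_pi.1 hv i) (htS i) hvi]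
      with s hs
    linarith

theorem le_of_hasDerivAt_of_isMax {x : ℝ → ι → ℝ} {a b c : ℝ} (hab : a ≤ b)
    (hx : ContinuousOn x (Set.Icc a b))
    (hder : ∀ t ∈ Set.Ioo a b, ∃ v, HasDerivAt x v t ∧ ∀ i, (∀ j, x t j ≤ x t i) → v i ≤ 0)
    (hc : ∀ i, x a i ≤ c) (i : ι) : x b i ≤ c := by
  have hlen : 0 < 1 + (b - a) := by linarith
  refine le_of_forall_pos_le_add fun ε hε => ?_
  have h := le_add_mul_of_hasDerivAt_of_isMax hx hder hc (div_pos hε hlen)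
    (Set.right_mem_Icc.2 hab) i
  rwa [div_mul_cancel₀ ε hlen.ne'] at h

theorem spread_le_spread_of_hasDerivAt {n : ℕ} [Nonempty (Fin n)] {x : ℝ → Fin n → ℝ} {a b : ℝ}
    (hab : a ≤ b) (hx : ContinuousOn x (Set.Icc a b))
    (hder : ∀ t ∈ Set.Ioo a b, ∃ v, HasDerivAt x v t ∧
      (∀ i, (∀ j, x t j ≤ x t i) → v i ≤ 0) ∧ ∀ i, (∀ j, x t i ≤ x t j) → 0 ≤ v i) :
    spread (x b) ≤ spread (x a) := by
  have hmax : ∀ i, x b i ≤ ⨆ j, x a j :=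
    le_of_hasDerivAt_of_isMax hab hx
      (fun t ht => (hder t ht).imp fun v hv => ⟨hv.1, hv.2.1⟩)
      (le_ciSup (Set.finite_range (x a)).bddAbove)
  have hmin : ∀ i, -x b i ≤ -⨅ j, x a j :=
    le_of_hasDerivAt_of_isMax hab hx.neg
      (fun t ht => by
        obtain ⟨v, hv, -, hv0⟩ := hder t ht
        exact ⟨-v, hv.neg, fun i hi => neg_nonpos.2 (hv0 i fun j => neg_le_neg_iff.1 (hi j))⟩)
      fun i => neg_le_neg (ciInf_le (Set.finite_range (x a)).bddBelow i)
  exact sub_le_sub (ciSup_le hmax) (le_ciInf fun i => neg_le_neg_iff.1 (hmin i))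

end MaximumPrinciple

section FixedTopology

theorem hasDerivAt_dotProduct_mulVec_of_isSymm {ι : Type*} [Fintype ι] {A : Matrix ι ι ℝ}
    (hA : A.IsSymm) {x : ℝ → ι → ℝ} {v : ι → ℝ} {t : ℝ} (hx : HasDerivAt x v t) :
    HasDerivAt (fun s => x s ⬝ᵥ A *ᵥ x s) (2 * (v ⬝ᵥ A *ᵥ x t)) t := by
  have hAx : HasDerivAt (fun s => A *ᵥ x s) (A *ᵥ v) t :=
    (Matrix.mulVecLin A).toContinuousLinearMap.hasFDerivAt.comp_hasDerivAt t hx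
  have hsum : HasDerivAt (fun s => x s ⬝ᵥ A *ᵥ x s) (v ⬝ᵥ A *ᵥ x t + x t ⬝ᵥ A *ᵥ v) t := by
    rw [dotProduct, dotProduct, ← Finset.sum_add_distrib]
    exact HasDerivAt.fun_sum fun i _ => (hasDerivAt_pi.1 hx i).mul (hasDerivAt_pi.1 hAx i)
  have hsymm : x t ⬝ᵥ A *ᵥ v = v ⬝ᵥ A *ᵥ x t := by
    rw [Matrix.dotProduct_mulVec, ← Matrix.mulVec_transpose, hA.eq, dotProduct_comm]
  rwa [hsymm, ← two_mul] at hsum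

variable {n : ℕ} {G : SimpleGraph (Fin n)} {ξ : ℝ} {d : ℝ → Fin n → Fin n → ℝ}
  {x : ℝ → Fin n → ℝ}

theorem IsFixedTrajectoryOn.exists_hasDerivAt {J : Set ℝ} (hx : IsFixedTrajectoryOn J G ξ d x)
    {t : ℝ} (ht : t ∈ interior J) : ∃ v, IsLazyControl G ξ (d t) (x t) v ∧ HasDerivAt x v t :=
  hx.2 t ht fun ⟨_, _, _, hkl, _⟩ => hkl rfl

theorem IsFixedTrajectoryOn.dirichletEnergy_sub_le [DecidableRel G.Adj] {a b η : ℝ} (hab : a ≤ b)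
    (hx : IsFixedTrajectoryOn (Set.Icc a b) G ξ d x)
    (hd : ∀ t ∈ Set.Ioo a b, d t ∈ disturbanceBox n ξ) (hη : 0 ≤ η)
    (hi : ∀ t ∈ Set.Ioo a b, ∃ i, 2 * G.degree i * ξ + η ≤ |(G.lapMatrix ℝ *ᵥ x t) i|) :
    dirichletEnergy G (x b) - dirichletEnergy G (x a) ≤ -(2 * η ^ 2) * (b - a) := by
  have hder : ∀ t ∈ Set.Ioo a b,
      ∃ e ≤ -(2 * η ^ 2), HasDerivAt (fun s => dirichletEnergy G (x s)) e t := fun t ht => by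
    obtain ⟨v, hv, hxv⟩ := hx.exists_hasDerivAt (by rwa [interior_Icc])
    obtain ⟨i, hti⟩ := hi t ht
    have hdiss := hv.dotProduct_lapMatrix_mulVec_le (hd t ht) hη hti
    exact ⟨_, by linarith, hasDerivAt_dotProduct_mulVec_of_isSymm (G.isSymm_lapMatrix ℝ) hxv⟩
  refine (convex_Icc a b).image_sub_le_mul_sub_of_deriv_le
    ((continuous_dirichletEnergy G).comp_continuousOn hx.1) (fun t ht => ?_) (fun t ht => ?_)
    a (Set.left_mem_Icc.2 hab) b (Set.right_mem_Icc.2 hab) hab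
  · obtain ⟨e, -, he⟩ := hder t (interior_Icc (a := a) ▸ ht)
    exact he.differentiableAt.differentiableWithinAt
  · obtain ⟨e, hle, he⟩ := hder t (interior_Icc (a := a) ▸ ht)
    exact he.deriv.trans_le hle

theorem exists_isSettlingTime [Nontrivial (Fin n)] (hG : G.Connected) (hξ : 0 ≤ ξ) {ν γ : ℝ}
    (hν : 0 < ν) (hγ : 0 < γ) : ∃ q, IsSettlingTime G ξ ν γ q := by
  classical
  have hn : (0 : ℝ) < n := by exact_mod_cast Fin.pos_iff_nonempty.2 hG.nonempty
  obtain ⟨δ, hδ, hexcess⟩ := exists_excess_of_notMem_fatten_setP hG hξ hν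
  set q : ℝ := n ^ 2 / (δ * γ) ^ 2 with hq
  have hq0 : 0 < q := by positivity
  refine ⟨q, hq0, fun d hd t ht x hx => ?_⟩
  by_contra! hno
  have htq : t ≤ t + q := by linarith
  have hV : 0 < spread (x t) := by
    by_contra! hV
    exact (hno t (Set.left_mem_Icc.2 htq)).2 <| mem_fatten_setP_of_spread_le
      (fun i => hG.preconnected.degree_pos_of_nontrivial i) hξ (hV.trans hν.le)
  have hdrop := hx.dirichletEnergy_sub_le htq
    (fun s hs => hd.2 s (ht.trans hs.1.le)) (η := δ * (γ * spread (x t))) (by positivity)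
    fun s hs => by
      obtain ⟨hspread, hmem⟩ := hno s (Set.Ioo_subset_Icc_self hs)
      obtain ⟨i, hi⟩ := hexcess _ hmem
      exact ⟨i, le_trans (by gcongr) hi⟩
  have hqη : (δ * (γ * spread (x t))) ^ 2 * q = n ^ 2 * spread (x t) ^ 2 := by
    rw [hq]
    field_simp
  have hpos : 0 < (n : ℝ) ^ 2 * spread (x t) ^ 2 := by positivity
  linarith [dirichletEnergy_le_sq_spread G (x t), dirichletEnergy_nonneg G (x (t + q))]

end FixedTopology

section Switching

variable {I : Type*} {σ : ℝ → I}

theorem IsSwitchingFunction.eventually_notMem_switchingTimes (hσ : IsSwitchingFunction σ) {t : ℝ}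
    (ht : 0 ≤ t) : ∀ᶠ s in 𝓝[>] t, s ∉ switchingTimes σ := by
  filter_upwards [eventually_eventually_nhdsWithin.2 (hσ.1 t ht), self_mem_nhdsWithin] with s hs hts
  rw [isOpen_Ioi.nhdsWithin_eq hts] at hs
  rintro ⟨-, k, l, hkl, hk, hl⟩
  obtain ⟨r, hrk, hr⟩ := (hk.and (hs.filter_mono nhdsWithin_le_nhds)).exists
  obtain ⟨u, hul, hu⟩ := (hl.and (hs.filter_mono nhdsWithin_le_nhds)).exists
  exact hkl (hrk.symm.trans (hr.trans (hu.symm.trans hul)))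

theorem IsSwitchingFunction.eventually_eq_of_notMem (hσ : IsSwitchingFunction σ) {t : ℝ}
    (ht : 0 < t) (htσ : t ∉ switchingTimes σ) : ∀ᶠ s in 𝓝 t, σ s = σ t := by
  have hright := hσ.1 t ht.le
  obtain ⟨k, hleft⟩ := hσ.2 t ht
  have hk : k = σ t := by
    by_contra hne
    exact htσ ⟨ht, k, σ t, hne, hleft, hright⟩
  rw [← nhdsNE_sup_pure, ← nhdsLT_sup_nhdsGT]
  exact eventually_sup.2 ⟨eventually_sup.2 ⟨hk ▸ hleft, hright⟩, rfl⟩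

theorem IsSwitchingFunction.eq_of_forall_notMem (hσ : IsSwitchingFunction σ) {a b : ℝ}
    (ha : 0 ≤ a) (h : ∀ t ∈ Set.Ioc a b, t ∉ switchingTimes σ) {t : ℝ} (ht : t ∈ Set.Icc a b) :
    σ t = σ a := by
  let _ : TopologicalSpace I := ⊥
  have : DiscreteTopology I := ⟨rfl⟩
  have hcont : ContinuousOn σ (Set.Icc a b) := by
    intro s hs
    rw [ContinuousWithinAt, nhds_discrete, tendsto_pure]
    rcases hs.1.eq_or_lt with rfl | has
    · refine Eventually.filter_mono (nhdsWithin_mono a Set.Icc_subset_Ici_self) ?_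
      rw [← Set.Ioi_insert, nhdsWithin_insert, eventually_sup]
      exact ⟨rfl, hσ.1 a ha⟩
    · exact (hσ.eventually_eq_of_notMem (ha.trans_lt has) (h s ⟨has, hs.2⟩)).filter_mono
        nhdsWithin_le_nhds
  exact isPreconnected_Icc.constant hcont ht (Set.left_mem_Icc.2 (ht.1.trans ht.2))

theorem HasDwellTime.notMem_switchingTimes {τ : ℝ} (hdwell : HasDwellTime σ τ) {a t : ℝ}
    (ha : a ∈ switchingTimes σ) (ht : t ∈ Set.Ioo a (a + τ)) : t ∉ switchingTimes σ := fun htσ => by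
  linarith [hdwell a ha t htσ ht.1, ht.2]

theorem HasDwellTime.exists_last_switchingTime {τ : ℝ} (hτ : 0 < τ) (hdwell : HasDwellTime σ τ)
    {c s : ℝ} (hc : c ∈ switchingTimes σ) (hcs : c ≤ s) :
    ∃ a ∈ switchingTimes σ, a ∈ Set.Icc c s ∧ ∀ t ∈ Set.Ioc a s, t ∉ switchingTimes σ := by
  have hbdd : BddAbove (switchingTimes σ ∩ Set.Icc c s) := ⟨s, fun _ hr => hr.2.2⟩
  have hne : (switchingTimes σ ∩ Set.Icc c s).Nonempty := ⟨c, hc, Set.left_mem_Icc.2 hcs⟩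
  obtain ⟨a, ⟨haσ, has⟩, ha⟩ := exists_lt_of_lt_csSup hne (sub_lt_self _ hτ)
  refine ⟨a, haσ, has, fun t ht htσ => ?_⟩
  have hle := le_csSup hbdd ⟨htσ, has.1.trans ht.1.le, ht.2⟩
  exact hdwell.notMem_switchingTimes haσ ⟨ht.1, by linarith⟩ htσ

theorem IsSwitchingFunction.exists_window (hσ : IsSwitchingFunction σ) {τ : ℝ} (hτ : 0 < τ)
    (hdwell : HasDwellTime σ τ) {k : I} (hk : ∃ᶠ t in atTop, σ t = k) {T : ℝ} (hT : 0 ≤ T) :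
    ∃ a, T ≤ a ∧ ∀ t ∈ Set.Ioo a (a + τ), σ t = k ∧ t ∉ switchingTimes σ := by
  obtain ⟨a, s, hTa, has, hsk, hs, hno⟩ : ∃ a s, T ≤ a ∧ a ≤ s ∧ σ s = k ∧
      (∀ t ∈ Set.Ioc a s, t ∉ switchingTimes σ) ∧
        ∀ t ∈ Set.Ioo a (a + τ), t ∉ switchingTimes σ := by
    by_cases hlate : ∃ c ∈ switchingTimes σ, T ≤ c
    · obtain ⟨c, hc, hTc⟩ := hlate
      obtain ⟨s, hsk, hcs⟩ := (hk.and_eventually (eventually_ge_atTop c)).exists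
      obtain ⟨a, haσ, has, hs⟩ := hdwell.exists_last_switchingTime hτ hc hcs
      exact ⟨a, s, hTc.trans has.1, has.2, hsk, hs, fun t => hdwell.notMem_switchingTimes haσ⟩
    · push Not at hlate
      obtain ⟨s, hsk, hTs⟩ := (hk.and_eventually (eventually_ge_atTop T)).exists
      exact ⟨s, s, hTs, le_rfl, hsk, by simp,
        fun t ht htσ => (hTs.trans ht.1.le).not_gt (hlate t htσ)⟩
  have ha : 0 ≤ a := hT.trans hTa
  refine ⟨a, hTa, fun t ht => ⟨?_, hno t ht⟩⟩
  calc σ t = σ a := hσ.eq_of_forall_notMem ha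
        (fun r hr => hno r ⟨hr.1, hr.2.trans_lt ht.2⟩) (Set.right_mem_Icc.2 ht.1.le)
    _ = σ s := (hσ.eq_of_forall_notMem ha hs (Set.right_mem_Icc.2 has)).symm
    _ = k := hsk

theorem IsRecurrent.frequently_eq (h : IsRecurrent σ) (k : I) : ∃ᶠ t in atTop, σ t = k :=
  frequently_atTop.2 fun t =>
    (h k (max t 0) (le_max_right t 0)).imp fun _ hs => ⟨(le_max_left t 0).trans hs.1, hs.2⟩

end Switching

section SwitchedDynamics

variable {n : ℕ} {I : Type*} {E : I → SimpleGraph (Fin n)} {σ : ℝ → I} {ξ : ℝ}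
  {d : ℝ → Fin n → Fin n → ℝ} {x : ℝ → Fin n → ℝ}

theorem IsTrajectoryOn.mono {J J' : Set ℝ} (hx : IsTrajectoryOn J E σ ξ d x) (hJ : J' ⊆ J) :
    IsTrajectoryOn J' E σ ξ d x :=
  ⟨hx.1.mono hJ, fun t ht => hx.2 t (interior_mono hJ ht)⟩

theorem IsTrajectoryOn.isFixedTrajectoryOn {J J' : Set ℝ} (hx : IsTrajectoryOn J E σ ξ d x)
    (hJ : J' ⊆ J) {k : I} (hk : ∀ t ∈ interior J', σ t = k ∧ t ∉ switchingTimes σ) :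
    IsFixedTrajectoryOn J' (E k) ξ d x :=
  ⟨hx.1.mono hJ, fun t ht _ => (hk t ht).1 ▸ hx.2 t (interior_mono hJ ht) (hk t ht).2⟩

theorem IsTrajectoryOn.spread_le_of_forall_notMem [Nonempty (Fin n)] {a b : ℝ} (hab : a ≤ b)
    (hx : IsTrajectoryOn (Set.Icc a b) E σ ξ d x)
    (hd : ∀ t ∈ Set.Ioo a b, d t ∈ disturbanceBox n ξ)
    (hσ : ∀ t ∈ Set.Ioo a b, t ∉ switchingTimes σ) : spread (x b) ≤ spread (x a) := by
  refine spread_le_spread_of_hasDerivAt hab hx.1 fun t ht => ?_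
  obtain ⟨v, hv, hxv⟩ := hx.2 t (by rwa [interior_Icc]) (hσ t ht)
  exact ⟨v, hxv, fun _ => hv.nonpos_of_forall_le (hd t ht),
    fun _ => hv.nonneg_of_forall_ge (hd t ht)⟩

theorem IsTrajectoryOn.antitoneOn_spread [Nonempty (Fin n)] (hσ : IsSwitchingFunction σ)
    (hd : ∀ t, 0 ≤ t → d t ∈ disturbanceBox n ξ) (hx : IsTrajectoryOn (Set.Ici 0) E σ ξ d x) :
    AntitoneOn (fun t => spread (x t)) (Set.Ici 0) := by
  intro a (ha : 0 ≤ a) b _ hab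
  have hsub {s t : ℝ} (hs : a ≤ s) : Set.Icc s t ⊆ Set.Ici 0 :=
    fun _ hr => ha.trans (hs.trans hr.1)
  let S : Set ℝ := {t | spread (x t) ≤ spread (x a)}
  suffices hS : Set.Icc a b ⊆ S from hS (Set.right_mem_Icc.2 hab)
  have hclosed : IsClosed (S ∩ Set.Icc a b) := by
    rw [Set.inter_comm]
    exact isClosed_Icc.isClosed_le
      (continuous_spread.comp_continuousOn (hx.1.mono (hsub le_rfl))) continuousOn_const
  refine hclosed.Icc_subset_of_forall_mem_nhdsWithin (le_refl (spread (x a))) ?_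
  rintro t ⟨htS : spread (x t) ≤ spread (x a), hat, -⟩
  have ht : 0 ≤ t := ha.trans hat
  obtain ⟨u, htu, hu⟩ := mem_nhdsGT_iff_exists_Ioo_subset.1 (hσ.eventually_notMem_switchingTimes ht)
  filter_upwards [Ioo_mem_nhdsGT htu] with s hs
  exact ((hx.mono (hsub hat)).spread_le_of_forall_notMem hs.1.le
    (fun r hr => hd r (ht.trans hr.1.le)) fun r hr => hu ⟨hr.1, hr.2.trans hs.2⟩).trans htS

variable [Nontrivial (Fin n)]

theorem fatten_setP_subset_tubeS {G : SimpleGraph (Fin n)} (hG : G.Connected) (hξ : 0 ≤ ξ)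
    {ν : ℝ} : fatten (setP ξ (disturbanceBox n ξ) G) ν ⊆ tubeS ξ (disturbanceBox n ξ) G ν := by
  rintro x ⟨y, hy, hxy⟩
  calc spread x ≤ spread y + 2 * ‖x - y‖ := spread_le_spread_add x y
    _ ≤ maxSpread ξ (disturbanceBox n ξ) G + 2 * ν := by
      gcongr
      exact (isGreatest_maxSpread hG hξ).2 (Set.mem_image_of_mem _ hy)

variable {k : I} {ν γ q τ : ℝ}

theorem IsTrajectoryOn.exists_spread_lt_or_mem_tubeS (hx : IsTrajectoryOn (Set.Ici 0) E σ ξ d x)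
    (hG : (E k).Connected) (hξ : 0 ≤ ξ) (hγ : 0 ≤ γ) (hq : IsSettlingTime (E k) ξ ν γ q)
    (hqτ : q ≤ τ) (hσ : IsSwitchingFunction σ) (hdwell : HasDwellTime σ τ)
    (hk : ∃ᶠ t in atTop, σ t = k) (hd : IsDisturbance ξ d) {T : ℝ} (hT : 0 ≤ T) :
    ∃ s ≥ T, spread (x s) < γ * spread (x T) ∨ x s ∈ tubeS ξ (disturbanceBox n ξ) (E k) ν := by
  obtain ⟨a, hTa, ha⟩ := hσ.exists_window (hq.1.trans_le hqτ) hdwell hk hT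
  have ha0 : 0 ≤ a := hT.trans hTa
  have hfixed : IsFixedTrajectoryOn (Set.Icc a (a + q)) (E k) ξ d x :=
    hx.isFixedTrajectoryOn (fun _ hr => ha0.trans hr.1) fun t ht => by
      rw [interior_Icc] at ht
      exact ha t ⟨ht.1, ht.2.trans_le (by gcongr)⟩
  obtain ⟨s, hs, h⟩ := hq.2 d hd a ha0 x hfixed
  refine ⟨s, hTa.trans hs.1, h.imp (fun hlt => hlt.trans_le ?_)
    fun hmem => fatten_setP_subset_tubeS hG hξ hmem⟩
  exact mul_le_mul_of_nonneg_left (hx.antitoneOn_spread hσ hd.2 hT ha0 hTa) hγ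

theorem IsTrajectoryOn.eventually_mem_tubeS (hx : IsTrajectoryOn (Set.Ici 0) E σ ξ d x)
    (hG : (E k).Connected) (hξ : 0 ≤ ξ) (hν : 0 < ν) (hγ0 : 0 ≤ γ) (hγ1 : γ < 1)
    (hq : IsSettlingTime (E k) ξ ν γ q) (hqτ : q ≤ τ) (hσ : IsSwitchingFunction σ)
    (hdwell : HasDwellTime σ τ) (hk : ∃ᶠ t in atTop, σ t = k) (hd : IsDisturbance ξ d) :
    ∀ᶠ t in atTop, x t ∈ tubeS ξ (disturbanceBox n ξ) (E k) ν := by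
  have hanti := hx.antitoneOn_spread hσ hd.2
  suffices h : ∃ s ≥ 0, x s ∈ tubeS ξ (disturbanceBox n ξ) (E k) ν by
    obtain ⟨s, hs0, hs⟩ := h
    filter_upwards [eventually_ge_atTop s] with t hst
    exact (hanti hs0 (hs0.trans hst) hst).trans hs
  by_contra! hout
  have hdecay : ∀ m : ℕ, ∃ s ≥ 0, spread (x s) ≤ γ ^ m * spread (x 0) := fun m => by
    induction m with
    | zero => exact ⟨0, le_rfl, by simp⟩
    | succ m ih =>
      obtain ⟨T, hT, hle⟩ := ih
      obtain ⟨s, hTs, h⟩ :=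
        hx.exists_spread_lt_or_mem_tubeS hG hξ hγ0 hq hqτ hσ hdwell hk hd hT
      have hs : 0 ≤ s := le_trans hT hTs
      refine ⟨s, hs, (h.resolve_right (hout s hs)).le.trans ?_⟩
      rw [pow_succ', mul_assoc]
      exact mul_le_mul_of_nonneg_left hle hγ0
  have htendsto : Tendsto (fun m : ℕ => γ ^ m * spread (x 0)) atTop (𝓝 0) := by
    simpa using (tendsto_pow_atTop_nhds_zero_of_lt_one hγ0 hγ1).mul_const (spread (x 0))
  have hpos : 0 < maxSpread ξ (disturbanceBox n ξ) (E k) + 2 * ν := by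
    linarith [maxSpread_nonneg hG hξ]
  obtain ⟨m, hm⟩ := (htendsto.eventually_lt_const hpos).exists
  obtain ⟨s, hs, hle⟩ := hdecay m
  exact hout s hs (hle.trans hm.le)

end SwitchedDynamics

theorem theorem4_general {n : ℕ} (hn : 2 ≤ n) {I : Type*} (E : I → SimpleGraph (Fin n)) (K : Set I)
    (hE : ∀ k ∈ K, (E k).Connected) (ξ ν γ : ℝ) (hξ : 0 ≤ ξ) (hν : 0 < ν) (hγ0 : 0 < γ)
    (hγ1 : γ < 1) :
    (∀ k ∈ K, IsGreatest (spread '' setP ξ (disturbanceBox n ξ) (E k))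
      (maxSpread ξ (disturbanceBox n ξ) (E k))) ∧
    (∀ k ∈ K, ∃ q, IsSettlingTime (E k) ξ ν γ q) ∧
    ∀ (q : I → ℝ) (τ : ℝ), (∀ k ∈ K, IsSettlingTime (E k) ξ ν γ (q k) ∧ q k ≤ τ) →
      ∀ σ : ℝ → I, IsSwitchingFunction σ → HasDwellTime σ τ → (∀ k ∈ K, ∃ᶠ t in atTop, σ t = k) →
      ∀ d : ℝ → Fin n → Fin n → ℝ, IsDisturbance ξ d →
      ∀ x : ℝ → Fin n → ℝ, IsTrajectoryOn (Set.Ici 0) E σ ξ d x →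
        ∃ T : ℝ, 0 < T ∧ ∀ t, T ≤ t →
          x t ∈ ⋂ k ∈ K, tubeS ξ (disturbanceBox n ξ) (E k) ν := by
  have : Nontrivial (Fin n) := Fin.nontrivial_iff_two_le.2 hn
  refine ⟨fun k hk => isGreatest_maxSpread (hE k hk) hξ,
    fun k hk => exists_isSettlingTime (hE k hk) hξ hν hγ0,
    fun q τ hq σ hσ hdwell hrec d hd x hx => ?_⟩
  have heach : ∀ G ∈ E '' K, ∀ᶠ t in atTop, x t ∈ tubeS ξ (disturbanceBox n ξ) G ν := by
    rintro _ ⟨k, hk, rfl⟩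
    exact hx.eventually_mem_tubeS (hE k hk) hξ hν hγ0.le hγ1 (hq k hk).1 (hq k hk).2 hσ hdwell
      (hrec k hk) hd
  -- `K` may be infinite, but there are only finitely many graphs on `Fin n`.
  have hall := (eventually_all_finite (Set.toFinite (E '' K))).2 heach
  obtain ⟨T, hT⟩ := ((eventually_gt_atTop 0).and hall).exists_forall_of_atTop
  exact ⟨T, (hT T le_rfl).1, fun t ht =>
    Set.mem_iInter₂.2 fun k hk => (hT t ht).2 (E k) (Set.mem_image_of_mem E hk)⟩

theorem theorem4 {n : ℕ} (hn : 2 ≤ n) {I : Type*} [Finite I]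
    (E : I → SimpleGraph (Fin n)) (hE : ∀ k, (E k).Connected)
    (ξ ν γ : ℝ) (hξ : 0 < ξ) (hν : 0 < ν) (hγ0 : 0 < γ) (hγ1 : γ < 1) :
    -- the maxima `L(D, E_k)` and the times `q_k(ν, γ)` exist
    (∀ k, IsGreatest (spread '' setP ξ (disturbanceBox n ξ) (E k))
      (maxSpread ξ (disturbanceBox n ξ) (E k))) ∧
    (∀ k, ∃ q, IsSettlingTime (E k) ξ ν γ q) ∧
    -- with the dwell time `max_k q_k(ν, γ)`, the state is driven in finite time to the tube
    ∀ q : I → ℝ, (∀ k, IsSettlingTime (E k) ξ ν γ (q k)) →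
      ∀ σ : ℝ → I, IsSwitchingFunction σ → HasDwellTime σ (⨆ k, q k) → IsRecurrent σ →
      ∀ d : ℝ → Fin n → Fin n → ℝ, IsDisturbance ξ d →
      ∀ x : ℝ → Fin n → ℝ, IsTrajectoryOn (Set.Ici 0) E σ ξ d x →
        ∃ T : ℝ, 0 < T ∧ ∀ t, T ≤ t →
          x t ∈ ⋂ k, tubeS ξ (disturbanceBox n ξ) (E k) ν := by
  obtain ⟨hmax, hsettle, hconv⟩ :=
    theorem4_general hn E Set.univ (fun k _ => hE k) ξ ν γ hξ.le hν hγ0 hγ1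
  refine ⟨fun k => hmax k trivial, fun k => hsettle k trivial,
    fun q hq σ hσ hdwell hrec d hd x hx => ?_⟩
  simpa only [Set.biInter_univ] using hconv q _
    (fun k _ => ⟨hq k, le_ciSup (Set.finite_range q).bddAbove k⟩) σ hσ hdwell
    (fun k _ => hrec.frequently_eq k) d hd x hx
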